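/- Let $v\in L^2(\mathbb R^2;\mathbb R^2)\cap C^1(\mathbb R^2;\mathbb R^2)$ be a solution of the stationary Euler equations $$v\cdot\nabla v=-\nabla p,\qquad \operatorname{div} v=0\qquad\text{pointwise in }\mathbb R^2,$$ for some differentiable pressure $p:\mathbb R^2\to\mathbb R$. Let $\mathbf S=\{x\in\mathbb R^2: v(x)=0\}$ be its stagnation set, and let $u$ be its stream function, i.e. a function $u:\mathbb R^2\to\mathbb R$ with $v=(\nabla u)^\perp=(-\partial_{x_2}u,\partial_{x_1}u)$; such a $u$ exists and is unique up to an additive constant. Then: (A1) $\mathbf S\neq\emptyset$. (A2) If $\mathbf S\neq\mathbb R^2$ and $\mathbf S$ is connected, then, after possibly replacing $u$ by $-u$ and adding a constant, the function $u$ is of class $C^2$ and: i) $u(x)=1=\max_{\mathbb R^2}u$ for all $x\in\mathbf S$; ii) $\lim_{|x|\to+\infty}u(x)=\inf_{\mathbb R^2}u=L$ for some $L\in[-\infty,1)$; iii) $u(x)\in(L,1]$ for every $x\in\mathbb R^2$, and there is a continuous function $f:(L,1]\to\mathbb R$ such that $-\Delta u=f(u)$ in $\mathbb R^2$. -/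

import Mathlib

open Filter Topology MeasureTheory

/-- The Euclidean plane. -/
abbrev Plane : Type := EuclideanSpace ℝ (Fin 2)

noncomputable section

/-- The partial derivative `∂_i g` of a scalar function on the plane. -/
def partialDeriv (i : Fin 2) (g : Plane → ℝ) (x : Plane) : ℝ :=
  fderiv ℝ g x (EuclideanSpace.single i 1)

/-- The divergence `∂₁ v₁ + ∂₂ v₂` of a planar vector field. -/
def divergence (v : Plane → Plane) (x : Plane) : ℝ :=
  ∑ i : Fin 2, partialDeriv i (fun y => v y i) x

/-- The convective term `v · ∇v`, with `i`-th component `∑ j, v_j ∂_j v_i`. -/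
def convection (v : Plane → Plane) (x : Plane) : Plane :=
  WithLp.toLp 2 fun i => ∑ j : Fin 2, v x j * partialDeriv j (fun y => v y i) x

/-- `v` is a classical solution of the stationary incompressible Euler equations in the plane:
`v` is of class `C¹`, and `v · ∇v = -∇p`, `div v = 0` hold pointwise for some pressure `p`. -/
structure IsStationaryEuler (v : Plane → Plane) : Prop where
  contDiff : ContDiff ℝ 1 v
  momentum : ∃ p : Plane → ℝ, Differentiable ℝ p ∧
    ∀ x, convection v x = - gradient p x
  incompressible : ∀ x, divergence v x = 0

/-- `u` is a stream function of `v`, that is, `v = (∇u)^⊥ = (-∂₂ u, ∂₁ u)`. -/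
structure IsStreamFunction (u : Plane → ℝ) (v : Plane → Plane) : Prop where
  differentiable : Differentiable ℝ u
  eq_perp : ∀ x, v x = !₂[- partialDeriv 1 u x, partialDeriv 0 u x]

/-- The set of stagnation points of a velocity field. -/
def stagnationSet (v : Plane → Plane) : Set Plane := {x | v x = 0}

end

/-!
A field `v` with `div v = 0` on the plane has a stream function `u` (Poincaré lemma), of class `C²`,
whose critical points are the stagnation points. The proof rests on three facts.

*Small oscillation.* As `∇u` is square integrable, the oscillation of `u` on circles `|x| = R` is
arbitrarily small for suitable large `R` (`exists_small_oscillation_sphere`). With the maximum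
principle on discs and annuli this gives everything about the range of `u`: without critical points
`u` would be constant; if all critical values are equal to `c`, then `u` lies on one side of `c`; a
connected critical set is bounded, and `u` tends to its infimum at infinity. That a connected
critical set carries a single critical value is Sard's theorem (`volume_image_critical_eq_zero`),
proved here through the Hölder estimate `|u x - u y| ≤ C |x - y|²` between critical points and
Hausdorff measures.

*Connected level sets.* For `t` below the maximum, `{t ≤ u}` is connected because each of its parts
contains a maximum, and `{u ≤ t}` is connected because a bounded part would contain a minimum. The
plane is unicoherent (`IsPreconnected.inter_of_union_eq_univ`), so the intersection `{u = t}` is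
connected. This takes the place of an argument with nested Jordan curves.

*Bernoulli function.* The Euler equations say that `H = p + |v|² / 2` satisfies `∇H = Δu ∇u`. In a
chart with `u` as second coordinate, `H` depends on `u` alone and `Δu` is its derivative, so `Δu` is
locally constant on regular level sets (`eventually_eq_of_hasFDerivAt_smul`), hence constant on each
level set `{u = t}` with `t < max u`. On the critical set it is the limit of these constants, or zero
if that set has interior points. So `Δu` is a function of `u`, and it is a continuous one because
`u` is proper above its infimum.
-/

open scoped NNReal ENNReal

/-! ### Stream functions and the Bernoulli function -/

/-- The rotation of a vector `a` by `-π/2`, regarded as the linear form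
`h ↦ a₁ h₀ - a₀ h₁`. -/
noncomputable def perpForm : Plane →L[ℝ] Plane →L[ℝ] ℝ :=
  (EuclideanSpace.proj 1 : Plane →L[ℝ] ℝ).smulRight (EuclideanSpace.proj 0 : Plane →L[ℝ] ℝ) -
    (EuclideanSpace.proj 0 : Plane →L[ℝ] ℝ).smulRight (EuclideanSpace.proj 1 : Plane →L[ℝ] ℝ)

@[simp]
lemma perpForm_apply (a h : Plane) : perpForm a h = a 1 * h 0 - a 0 * h 1 := by
  simp [perpForm]

lemma Plane.eq_sum (h : Plane) :
    h = h 0 • EuclideanSpace.single 0 1 + h 1 • EuclideanSpace.single 1 1 := by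
  ext i
  fin_cases i <;> simp

lemma ContinuousLinearMap.apply_eq_plane {F : Type*} [NormedAddCommGroup F] [NormedSpace ℝ F]
    (T : Plane →L[ℝ] F) (h : Plane) :
    T h = h 0 • T (EuclideanSpace.single 0 1) + h 1 • T (EuclideanSpace.single 1 1) := by
  conv_lhs => rw [Plane.eq_sum h]
  simp

lemma perpForm_eq_zero {a : Plane} : perpForm a = 0 ↔ a = 0 := by
  refine ⟨fun h => ?_, fun h => by simp [h]⟩
  have h0 := congrArg (fun T : Plane →L[ℝ] ℝ => T (EuclideanSpace.single 0 1)) h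
  have h1 := congrArg (fun T : Plane →L[ℝ] ℝ => T (EuclideanSpace.single 1 1)) h
  ext i
  fin_cases i
  · simpa using h1
  · simpa using h0

/-- `u` is a stream function of `v` iff `du` is the rotated velocity `v₁ dx₀ - v₀ dx₁`. -/
lemma isStreamFunction_iff {u : Plane → ℝ} {v : Plane → Plane} :
    IsStreamFunction u v ↔ ∀ x, HasFDerivAt u (perpForm (v x)) x := by
  constructor
  · intro h x
    have e : fderiv ℝ u x = perpForm (v x) := by
      ext z
      rw [ContinuousLinearMap.apply_eq_plane, perpForm_apply, h.eq_perp x]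
      simp [partialDeriv]
      ring
    exact e ▸ (h.differentiable x).hasFDerivAt
  · intro h
    refine ⟨fun x => (h x).differentiableAt, fun x => ?_⟩
    ext i
    fin_cases i <;> simp [partialDeriv, (h x).fderiv]

lemma fderiv_coord {v : Plane → Plane} (hv : Differentiable ℝ v) (i : Fin 2) (x h : Plane) :
    fderiv ℝ (fun y => v y i) x h = fderiv ℝ v x h i := by
  have : HasFDerivAt (fun y => v y i)
      ((EuclideanSpace.proj i : Plane →L[ℝ] ℝ).comp (fderiv ℝ v x)) x :=
    (EuclideanSpace.proj i : Plane →L[ℝ] ℝ).hasFDerivAt.comp x (hv x).hasFDerivAt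
  rw [this.fderiv]
  rfl

/-- The Poincaré lemma: `div v = 0` says that the form `v₁ dx₀ - v₀ dx₁` is closed. -/
lemma exists_streamFunction {v : Plane → Plane} (hv : ContDiff ℝ 1 v)
    (hdiv : ∀ x, divergence v x = 0) : ∃ u : Plane → ℝ, IsStreamFunction u v := by
  have hvd := hv.differentiable (by norm_num)
  have hder : ∀ x, HasFDerivAt (fun y => perpForm (v y)) (perpForm.comp (fderiv ℝ v x)) x :=
    fun x => perpForm.hasFDerivAt.comp x (hvd x).hasFDerivAt
  obtain ⟨u, hu⟩ := (convex_univ (𝕜 := ℝ) (E := Plane)).exists_forall_hasFDerivAt_of_fderiv_symmetric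
    (ω := fun y => perpForm (v y)) isOpen_univ
    (fun x _ => (hder x).differentiableAt.differentiableWithinAt) (by
      intro x _ a b
      have h := hdiv x
      simp only [divergence, partialDeriv, fderiv_coord hvd, Fin.sum_univ_two] at h
      rw [(hder x).fderiv]
      simp only [ContinuousLinearMap.comp_apply, perpForm_apply]
      rw [ContinuousLinearMap.apply_eq_plane (fderiv ℝ v x) a,
        ContinuousLinearMap.apply_eq_plane (fderiv ℝ v x) b]
      simp only [PiLp.add_apply, PiLp.smul_apply, smul_eq_mul]
      linear_combination (a 0 * b 1 - a 1 * b 0) * (-1) * h)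
  exact ⟨u, isStreamFunction_iff.2 fun x => hu x (Set.mem_univ x)⟩

lemma laplacian_eq_sum (u : Plane → ℝ) (x : Plane) :
    Laplacian.laplacian u x =
      ∑ i : Fin 2, fderiv ℝ (fderiv ℝ u) x (EuclideanSpace.single i 1)
        (EuclideanSpace.single i 1) := by
  rw [InnerProductSpace.laplacian_eq_iteratedFDeriv_orthonormalBasis u
    (EuclideanSpace.basisFun (Fin 2) ℝ)]
  simp [iteratedFDeriv_two_apply]

namespace IsStreamFunction

variable {u : Plane → ℝ} {v : Plane → Plane}

lemma fderiv_eq (h : IsStreamFunction u v) : fderiv ℝ u = fun x => perpForm (v x) :=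
  funext fun x => (isStreamFunction_iff.1 h x).fderiv

lemma contDiff_two (h : IsStreamFunction u v) (hv : ContDiff ℝ 1 v) : ContDiff ℝ 2 u := by
  rw [show (2 : WithTop ℕ∞) = 1 + 1 by norm_num, contDiff_succ_iff_fderiv]
  refine ⟨h.differentiable, by simp, ?_⟩
  rw [h.fderiv_eq]
  exact perpForm.contDiff.comp hv

lemma stagnationSet_eq (h : IsStreamFunction u v) : stagnationSet v = {x | fderiv ℝ u x = 0} := by
  ext x
  simp [stagnationSet, h.fderiv_eq, perpForm_eq_zero]

lemma exists_eq_add_const {u₁ u₂ : Plane → ℝ} (h₁ : IsStreamFunction u₁ v)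
    (h₂ : IsStreamFunction u₂ v) : ∃ c : ℝ, ∀ x, u₂ x = u₁ x + c := by
  refine ⟨u₂ 0 - u₁ 0, fun x => ?_⟩
  have := is_const_of_fderiv_eq_zero (f := fun y => u₂ y - u₁ y) (𝕜 := ℝ)
    (h₂.differentiable.sub h₁.differentiable) (fun y => by
      rw [fderiv_fun_sub (h₂.differentiable y) (h₁.differentiable y), h₁.fderiv_eq, h₂.fderiv_eq,
        sub_self]) x 0
  linarith

lemma laplacian_eq (h : IsStreamFunction u v) (hv : ContDiff ℝ 1 v) (x : Plane) :
    Laplacian.laplacian u x = fderiv ℝ v x (EuclideanSpace.single 0 1) 1 -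
      fderiv ℝ v x (EuclideanSpace.single 1 1) 0 := by
  have hder : HasFDerivAt (fun y => perpForm (v y)) (perpForm.comp (fderiv ℝ v x)) x :=
    perpForm.hasFDerivAt.comp x (hv.differentiable (by norm_num) x).hasFDerivAt
  rw [laplacian_eq_sum, h.fderiv_eq, hder.fderiv]
  simp [sub_eq_add_neg]

/-- The Bernoulli function `H = p + |v|² / 2` satisfies `∇H = Δu ∇u`, where the Laplacian `Δu` of the
stream function is the vorticity of `v`. Only first derivatives of `v` enter. -/
lemma exists_bernoulli (h : IsStreamFunction u v) (hE : IsStationaryEuler v) :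
    ∃ H : Plane → ℝ, ∀ x, HasFDerivAt H (Laplacian.laplacian u x • fderiv ℝ u x) x := by
  obtain ⟨p, hp, hmom⟩ := hE.momentum
  have hvd := hE.contDiff.differentiable (by norm_num)
  refine ⟨fun x => p x + (v x 0 ^ 2 + v x 1 ^ 2) / 2, fun x => ?_⟩
  have hc : ∀ i : Fin 2, HasFDerivAt (fun y => v y i)
      ((EuclideanSpace.proj i : Plane →L[ℝ] ℝ).comp (fderiv ℝ v x)) x := fun i =>
    (EuclideanSpace.proj i : Plane →L[ℝ] ℝ).hasFDerivAt.comp x (hvd x).hasFDerivAt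
  have hH := (hp x).hasFDerivAt.add ((((hc 0).pow 2).add ((hc 1).pow 2)).mul_const (2⁻¹ : ℝ))
  refine hH.congr_fderiv ?_
  have hdiv := hE.incompressible x
  simp only [divergence, partialDeriv, fderiv_coord hvd, Fin.sum_univ_two] at hdiv
  have hpi : ∀ i : Fin 2, fderiv ℝ p x (EuclideanSpace.single i 1) =
      -∑ j : Fin 2, v x j * fderiv ℝ v x (EuclideanSpace.single j 1) i := by
    intro i
    have h1 : gradient p x i = fderiv ℝ p x (EuclideanSpace.single i 1) := by
      rw [← inner_gradient_left, EuclideanSpace.inner_single_right]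
      simp
    have h2 := congrArg (fun w : Plane => w i) (hmom x)
    simp only [convection, partialDeriv, fderiv_coord hvd, PiLp.neg_apply, h1] at h2
    linarith
  ext z
  rw [h.laplacian_eq hE.contDiff, h.fderiv_eq]
  simp only [add_apply, smul_apply,
    ContinuousLinearMap.comp_apply, perpForm_apply, smul_eq_mul]
  rw [ContinuousLinearMap.apply_eq_plane (fderiv ℝ p x) z, hpi, hpi,
    ContinuousLinearMap.apply_eq_plane (fderiv ℝ v x) z]
  simp
  ring

end IsStreamFunction

/-! ### Oscillation on large circles -/

/-- If `F` is integrable over the plane and `g(R)` is its integral over angles at radius `R`, then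
`R² g(R)` is small for arbitrarily large `R`: otherwise `R g(R) ≥ ε / R`, which is not integrable
at infinity, against the formula for integration in polar coordinates. -/
lemma exists_sq_mul_integral_polar_lt {F : ℝ × ℝ → ℝ} (hF : Continuous F) (hF0 : ∀ p, 0 ≤ F p)
    (hfin : ∫⁻ p, ENNReal.ofReal (F p) ≠ ∞) {ε : ℝ} (hε : 0 < ε) (R₀ : ℝ) :
    ∃ R > R₀, 0 < R ∧
      R ^ 2 * ∫ θ in -Real.pi..Real.pi, F (R * Real.cos θ, R * Real.sin θ) < ε := by
  by_contra! hcon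
  set g : ℝ → ℝ := fun r => ∫ θ in -Real.pi..Real.pi, F (r * Real.cos θ, r * Real.sin θ) with hg
  have hpi : -Real.pi ≤ Real.pi := by linarith [Real.pi_pos]
  set R₁ := max R₀ 1 with hR₁
  have hpos : ∀ r ∈ Set.Ioi R₁, 0 < r := fun r hr =>
    lt_of_lt_of_le one_pos ((le_max_right R₀ 1).trans (le_of_lt hr))
  have hlow : ∀ r ∈ Set.Ioi R₁, ENNReal.ofReal (ε * r⁻¹) ≤
      ∫⁻ θ in Set.Ioo (-Real.pi) Real.pi,
        ENNReal.ofReal r * ENNReal.ofReal (F (r * Real.cos θ, r * Real.sin θ)) := by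
    intro r hr
    have hr0 := hpos r hr
    have hc : Continuous fun θ => F (r * Real.cos θ, r * Real.sin θ) := by fun_prop
    rw [lintegral_const_mul _ (by fun_prop), ← ofReal_integral_eq_lintegral_ofReal
      ((hc.integrableOn_Icc).mono_set Set.Ioo_subset_Icc_self) (ae_of_all _ fun _ => hF0 _),
      ← ENNReal.ofReal_mul hr0.le, ← integral_Ioc_eq_integral_Ioo,
      ← intervalIntegral.integral_of_le hpi]
    refine ENNReal.ofReal_le_ofReal ?_
    have := hcon r (lt_of_le_of_lt (le_max_left _ _) hr) hr0
    rw [← div_eq_mul_inv, div_le_iff₀ hr0]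
    calc ε ≤ _ := this
      _ = _ := by ring
  have hle : ∫⁻ r in Set.Ioi R₁, ENNReal.ofReal (ε * r⁻¹) ≤ ∫⁻ p, ENNReal.ofReal (F p) := by
    rw [← lintegral_comp_polarCoord_symm, polarCoord_target, Measure.volume_eq_prod,
      ← Measure.prod_restrict, lintegral_prod]
    · calc _ ≤ ∫⁻ r in Set.Ioi R₁, _ := setLIntegral_mono' measurableSet_Ioi hlow
        _ ≤ _ := lintegral_mono_set (Set.Ioi_subset_Ioi (by simp [hR₁]))
    · refine Measurable.aemeasurable ?_
      simp only [polarCoord_symm_apply, smul_eq_mul]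
      fun_prop
  have hint : IntegrableOn (fun r => ε * r⁻¹) (Set.Ioi R₁) := by
    refine ⟨by fun_prop, ?_⟩
    rw [hasFiniteIntegral_iff_ofReal]
    · exact hle.trans_lt hfin.lt_top
    · filter_upwards [ae_restrict_mem measurableSet_Ioi] with r hr
      have := hpos r hr
      simp only [Pi.zero_apply]
      positivity
  refine not_integrableOn_Ioi_inv (a := R₁) ?_
  have := hint.const_mul ε⁻¹
  simpa [IntegrableOn, ← mul_assoc, hε.ne'] using this

/-- The point of the plane with polar coordinates `(R, θ)`. -/
noncomputable def polarPoint (R θ : ℝ) : Plane := !₂[R * Real.cos θ, R * Real.sin θ]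

lemma exists_polarPoint_eq (x : Plane) :
    ∃ θ ∈ Set.Icc (-Real.pi) Real.pi, polarPoint ‖x‖ θ = x := by
  have hn : ‖x‖ = ‖(⟨x 0, x 1⟩ : ℂ)‖ := by
    rw [EuclideanSpace.norm_eq, Complex.norm_eq_sqrt_sq_add_sq]
    simp
  refine ⟨Complex.arg ⟨x 0, x 1⟩, ⟨(Complex.neg_pi_lt_arg _).le, Complex.arg_le_pi _⟩, ?_⟩
  ext i
  fin_cases i
  · simp [polarPoint, hn]
  · simp [polarPoint, hn]

lemma hasDerivAt_polarPoint (R θ : ℝ) :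
    HasDerivAt (polarPoint R) (!₂[-(R * Real.sin θ), R * Real.cos θ] : Plane) θ := by
  refine (PiLp.hasFDerivAt_toLp (𝕜 := ℝ) 2 _).comp_hasDerivAt θ
    (f' := ![-(R * Real.sin θ), R * Real.cos θ]) (hasDerivAt_pi.2 fun i => ?_)
  fin_cases i
  · simpa [polarPoint] using (Real.hasDerivAt_cos θ).const_mul R
  · simpa [polarPoint] using (Real.hasDerivAt_sin θ).const_mul R

lemma norm_deriv_polarPoint {R : ℝ} (hR : 0 ≤ R) (θ : ℝ) :
    ‖(!₂[-(R * Real.sin θ), R * Real.cos θ] : Plane)‖ = R := by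
  rw [EuclideanSpace.norm_eq, Real.sqrt_eq_iff_mul_self_eq (by positivity) hR]
  simp only [Fin.sum_univ_two, Real.norm_eq_abs, sq_abs]
  simp
  nlinarith [Real.sin_sq_add_cos_sq θ]

lemma abs_sub_le_integral_on_circle {u : Plane → ℝ} (hu : ContDiff ℝ 1 u) {R : ℝ} (hR : 0 ≤ R)
    {x y : Plane} (hx : ‖x‖ = R) (hy : ‖y‖ = R) :
    |u x - u y| ≤ ∫ θ in -Real.pi..Real.pi, ‖fderiv ℝ u (polarPoint R θ)‖ * R := by
  have hpc : Continuous (polarPoint R) :=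
    continuous_iff_continuousAt.2 fun θ => (hasDerivAt_polarPoint R θ).continuousAt
  have hc : Continuous fun θ => ‖fderiv ℝ u (polarPoint R θ)‖ * R :=
    (((hu.continuous_fderiv (by norm_num)).comp hpc).norm).mul continuous_const
  have main : ∀ a ∈ Set.Icc (-Real.pi) Real.pi, ∀ b ∈ Set.Icc (-Real.pi) Real.pi, a ≤ b →
      |u (polarPoint R b) - u (polarPoint R a)| ≤
        ∫ θ in -Real.pi..Real.pi, ‖fderiv ℝ u (polarPoint R θ)‖ * R := by
    intro a ha b hb hab
    have hder : ∀ θ, HasDerivAt (fun θ => u (polarPoint R θ))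
        (fderiv ℝ u (polarPoint R θ) (!₂[-(R * Real.sin θ), R * Real.cos θ] : Plane)) θ :=
      fun θ => ((hu.differentiable (by norm_num) _).hasFDerivAt).comp_hasDerivAt θ
        (hasDerivAt_polarPoint R θ)
    have hcd : Continuous fun θ =>
        fderiv ℝ u (polarPoint R θ) (!₂[-(R * Real.sin θ), R * Real.cos θ] : Plane) := by
      refine ((hu.continuous_fderiv (by norm_num)).comp hpc).clm_apply ?_
      exact (PiLp.continuous_toLp 2 _).comp (by fun_prop)
    rw [← intervalIntegral.integral_eq_sub_of_hasDerivAt (fun θ _ => hder θ)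
      (hcd.intervalIntegrable _ _)]
    refine (intervalIntegral.norm_integral_le_of_norm_le (E := ℝ) (μ := volume)
      (f := fun θ => fderiv ℝ u (polarPoint R θ)
        (!₂[-(R * Real.sin θ), R * Real.cos θ] : Plane))
      (g := fun θ => ‖fderiv ℝ u (polarPoint R θ)‖ * R) hab (ae_of_all _ fun θ _ => ?_)
      (hc.intervalIntegrable _ _)).trans ?_
    · refine (ContinuousLinearMap.le_opNorm _ _).trans_eq ?_
      rw [norm_deriv_polarPoint hR]
    · exact intervalIntegral.integral_mono_interval ha.1 hab hb.2
        (ae_of_all _ fun θ => by positivity) (hc.intervalIntegrable _ _)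
  obtain ⟨a, ha, rfl⟩ : ∃ θ ∈ Set.Icc (-Real.pi) Real.pi, polarPoint R θ = x := by
    rw [← hx]; exact exists_polarPoint_eq x
  obtain ⟨b, hb, rfl⟩ : ∃ θ ∈ Set.Icc (-Real.pi) Real.pi, polarPoint R θ = y := by
    rw [← hy]; exact exists_polarPoint_eq y
  rcases le_total a b with h | h
  · rw [abs_sub_comm]; exact main a ha b hb h
  · exact main b hb a ha h

lemma lintegral_prod_eq_lintegral_plane (f : Plane → ℝ≥0∞) (hf : Measurable f) :
    ∫⁻ p : ℝ × ℝ, f !₂[p.1, p.2] = ∫⁻ x, f x := by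
  have h1 := (PiLp.volume_preserving_toLp (Fin 2)).lintegral_comp hf
  have h2 := (MeasureTheory.volume_preserving_finTwoArrow ℝ).symm.lintegral_comp
    (hf.comp (PiLp.volume_preserving_toLp (Fin 2)).measurable)
  rw [← h1]
  refine Eq.trans ?_ h2
  refine lintegral_congr fun p => congrArg f ?_
  ext i
  fin_cases i <;> rfl

/-- A function with square integrable gradient has small oscillation on arbitrarily large
circles. -/
theorem exists_small_oscillation_sphere {u : Plane → ℝ} (hu : ContDiff ℝ 1 u)
    (hL2 : MemLp (fderiv ℝ u) 2 volume) {ε : ℝ} (hε : 0 < ε) (R₀ : ℝ) :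
    ∃ R > R₀, ∀ x y, ‖x‖ = R → ‖y‖ = R → |u x - u y| < ε := by
  have hcf : Continuous (fderiv ℝ u) := hu.continuous_fderiv (by norm_num)
  have hlp : Continuous fun p : ℝ × ℝ => (!₂[p.1, p.2] : Plane) :=
    (PiLp.continuous_toLp 2 _).comp (by fun_prop)
  have hfin : ∫⁻ p : ℝ × ℝ, ENNReal.ofReal (‖fderiv ℝ u !₂[p.1, p.2]‖ ^ 2) ≠ ∞ := by
    rw [lintegral_prod_eq_lintegral_plane (fun x => ENNReal.ofReal (‖fderiv ℝ u x‖ ^ 2))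
      (by fun_prop)]
    have := hL2.integrable_norm_pow (by norm_num)
    exact (this.lintegral_lt_top).ne
  have hpi := Real.pi_pos
  -- The pointwise bound `R |∇u| ≤ δ + R² |∇u|² / δ` replaces the Cauchy-Schwarz inequality; this
  -- `δ` makes the first summand contribute `ε / 2` to the integral over the circle.
  set δ := ε / (4 * Real.pi) with hδ
  have hδ0 : 0 < δ := by positivity
  obtain ⟨R, hR, hR0, hsmall⟩ := exists_sq_mul_integral_polar_lt
    (F := fun p => ‖fderiv ℝ u !₂[p.1, p.2]‖ ^ 2) (by fun_prop) (fun p => by positivity) hfin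
    (ε := δ * (ε / 2)) (by positivity) R₀
  refine ⟨R, hR, fun x y hx hy => (abs_sub_le_integral_on_circle hu hR0.le hx hy).trans_lt ?_⟩
  have hpc : Continuous (polarPoint R) :=
    continuous_iff_continuousAt.2 fun θ => (hasDerivAt_polarPoint R θ).continuousAt
  have hc : Continuous fun θ => ‖fderiv ℝ u (polarPoint R θ)‖ := (hcf.comp hpc).norm
  calc ∫ θ in -Real.pi..Real.pi, ‖fderiv ℝ u (polarPoint R θ)‖ * R
      ≤ ∫ θ in -Real.pi..Real.pi, (δ + δ⁻¹ * R ^ 2 * ‖fderiv ℝ u (polarPoint R θ)‖ ^ 2) := by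
        refine intervalIntegral.integral_mono (by linarith)
          ((hc.mul continuous_const).intervalIntegrable _ _)
          ((continuous_const.add (continuous_const.mul (hc.pow 2))).intervalIntegrable _ _) ?_
        intro θ
        simp only
        set w := ‖fderiv ℝ u (polarPoint R θ)‖
        have h1 : δ + δ⁻¹ * R ^ 2 * w ^ 2 - w * R =
            δ⁻¹ * ((δ - w * R / 2) ^ 2 + 3 / 4 * (w * R) ^ 2) := by
          field_simp
          ring
        have h2 : 0 ≤ δ⁻¹ * ((δ - w * R / 2) ^ 2 + 3 / 4 * (w * R) ^ 2) := by positivity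
        linarith
    _ = 2 * Real.pi * δ + δ⁻¹ * (R ^ 2 * ∫ θ in -Real.pi..Real.pi,
          ‖fderiv ℝ u (polarPoint R θ)‖ ^ 2) := by
        have hi : Continuous fun θ => δ⁻¹ * R ^ 2 * ‖fderiv ℝ u (polarPoint R θ)‖ ^ 2 :=
          continuous_const.mul (hc.pow 2)
        rw [intervalIntegral.integral_add (by simp) (hi.intervalIntegrable _ _),
          intervalIntegral.integral_const_mul]
        simp
        ring
    _ < 2 * Real.pi * δ + δ⁻¹ * (δ * (ε / 2)) := by
        have := mul_lt_mul_of_pos_left hsmall (inv_pos.2 hδ0)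
        exact add_lt_add_right this _
    _ = ε := by
        rw [hδ]
        field_simp
        ring

/-! ### Sard's theorem for functions on the plane -/

/-- On a set of critical points, `u` is `2`-Hölder, with constant a bound of the second
derivative. -/
lemma holderOnWith_two_of_critical {u : Plane → ℝ} (hu : ContDiff ℝ 2 u) {s K : Set Plane}
    (hK : Convex ℝ K) {C : ℝ≥0} (hC : ∀ x ∈ K, ‖fderiv ℝ (fderiv ℝ u) x‖ ≤ C)
    (hs : ∀ x ∈ s, fderiv ℝ u x = 0) (hsK : s ⊆ K) : HolderOnWith C 2 u s := by
  have hdu : Differentiable ℝ (fderiv ℝ u) :=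
    (hu.fderiv_right (m := 1) (by norm_num)).differentiable (by norm_num)
  have key : ∀ x ∈ s, ∀ y ∈ s, ‖u x - u y‖ ≤ C * ‖x - y‖ ^ 2 := by
    intro x hx y hy
    have h1 : ∀ z ∈ segment ℝ y x, ‖fderiv ℝ u z‖ ≤ C * ‖x - y‖ := by
      intro z hz
      have h2 := hK.norm_image_sub_le_of_norm_fderiv_le (𝕜 := ℝ) (f := fderiv ℝ u)
        (fun w _ => hdu w) hC (hsK hy) (hK.segment_subset (hsK hy) (hsK hx) hz)
      rw [hs y hy, sub_zero] at h2
      refine h2.trans (mul_le_mul_of_nonneg_left ?_ C.2)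
      obtain ⟨t, ht, rfl⟩ := (segment_eq_image_lineMap ℝ y x) ▸ hz
      rw [AffineMap.lineMap_apply, vsub_eq_sub, vadd_eq_add, add_sub_cancel_right, norm_smul,
        Real.norm_of_nonneg ht.1]
      exact mul_le_of_le_one_left (norm_nonneg _) ht.2
    have h3 := (convex_segment y x).norm_image_sub_le_of_norm_fderiv_le (𝕜 := ℝ) (f := u)
      (fun w _ => hu.differentiable (by norm_num) w) h1 (left_mem_segment ℝ y x)
      (right_mem_segment ℝ y x)
    nlinarith
  intro x hx y hy
  rw [edist_dist, edist_dist, dist_eq_norm, dist_eq_norm, ENNReal.ofReal_rpow_of_nonneg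
    (norm_nonneg _) (by norm_num), ← ENNReal.ofReal_coe_nnreal, ← ENNReal.ofReal_mul (p := (C : ℝ)) C.2]
  refine ENNReal.ofReal_le_ofReal ?_
  simpa using key x hx y hy

lemma volume_image_le_of_critical {u : Plane → ℝ} (hu : ContDiff ℝ 2 u) {s K : Set Plane}
    (hK : Convex ℝ K) {C : ℝ≥0} (hC : ∀ x ∈ K, ‖fderiv ℝ (fderiv ℝ u) x‖ ≤ C)
    (hs : ∀ x ∈ s, fderiv ℝ u x = 0) (hsK : s ⊆ K) :
    volume (u '' s) ≤ C * μH[2] s := by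
  have := (holderOnWith_two_of_critical hu hK hC hs hsK).hausdorffMeasure_image_le
    (by norm_num) (d := 1) zero_le_one
  simpa [hausdorffMeasure_real] using this

/-- The second derivative vanishes at almost every critical point, namely at the density points of
the critical set. -/
lemma ae_fderiv_fderiv_eq_zero {u : Plane → ℝ} (hu : ContDiff ℝ 2 u) :
    volume {x | fderiv ℝ u x = 0 ∧ fderiv ℝ (fderiv ℝ u) x ≠ 0} = 0 := by
  have hdu : ContDiff ℝ 1 (fderiv ℝ u) := hu.fderiv_right (by norm_num)
  let L := (InnerProductSpace.toDual ℝ Plane).symm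
  let L' : (Plane →L[ℝ] ℝ) ≃L[ℝ] Plane := L.toContinuousLinearEquiv
  have hder : ∀ x, HasFDerivAt (fun y => L' (fderiv ℝ u y))
      ((L' : (Plane →L[ℝ] ℝ) →L[ℝ] Plane).comp (fderiv ℝ (fderiv ℝ u) x)) x := fun x =>
    (L' : (Plane →L[ℝ] ℝ) →L[ℝ] Plane).hasFDerivAt.comp x
      (hdu.differentiable (by norm_num) x).hasFDerivAt
  have hmeas : MeasurableSet {x | fderiv ℝ u x = 0} :=
    (isClosed_singleton.preimage hdu.continuous).measurableSet
  have happ : ApproximatesLinearOn (fun y => L' (fderiv ℝ u y)) (0 : Plane →L[ℝ] Plane)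
      {x | fderiv ℝ u x = 0} 0 := by
    intro x hx y hy
    simp [Set.mem_ofPred.1 hx, Set.mem_ofPred.1 hy]
  have := happ.norm_fderiv_sub_le volume hmeas _ fun x _ => (hder x).hasFDerivWithinAt
  rw [ae_restrict_iff' hmeas, ae_iff] at this
  refine measure_mono_null ?_ this
  rintro x ⟨hx, hx'⟩
  simp only [Set.mem_ofPred_eq]
  intro h
  apply hx'
  have h0 := h hx
  simp only [sub_zero, nonpos_iff_eq_zero, nnnorm_eq_zero] at h0
  ext1 z
  simpa using congrArg (fun T : Plane →L[ℝ] Plane => T z) h0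

/-- Sard's theorem for `C²` functions on the plane. Critical points with nonzero second derivative
form a null set, whose image under the locally `2`-Hölder function `u` is null. Near those with zero
second derivative the Hölder constant is as small as desired. -/
theorem volume_image_critical_eq_zero {u : Plane → ℝ} (hu : ContDiff ℝ 2 u) :
    volume (u '' {x | fderiv ℝ u x = 0}) = 0 := by
  have hdu : ContDiff ℝ 1 (fderiv ℝ u) := hu.fderiv_right (by norm_num)
  have hddu : Continuous (fderiv ℝ (fderiv ℝ u)) := hdu.continuous_fderiv (by norm_num)
  have hnorm : Continuous fun x => ‖fderiv ℝ (fderiv ℝ u) x‖ :=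
    Continuous.norm (E := Plane →L[ℝ] Plane →L[ℝ] ℝ) hddu
  set S := {x | fderiv ℝ u x = 0} with hS
  have hSc : IsClosed S := isClosed_singleton.preimage hdu.continuous
  have hac : (μH[2] : Measure Plane) ≪ volume := by
    have : (μH[2] : Measure Plane).IsAddHaarMeasure :=
      inferInstanceAs (μH[(2 : ℕ)] : Measure (EuclideanSpace ℝ (Fin 2))).IsAddHaarMeasure
    exact Measure.absolutelyContinuous_isAddHaarMeasure _ _
  have hcov : u '' S ⊆ ⋃ n : ℕ, u '' (S ∩ Metric.closedBall 0 n) := by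
    rintro _ ⟨x, hx, rfl⟩
    obtain ⟨n, hn⟩ := exists_nat_ge ‖x‖
    exact Set.mem_iUnion.2 ⟨n, x, ⟨hx, by simpa using hn⟩, rfl⟩
  refine measure_mono_null hcov (measure_iUnion_null fun n => ?_)
  set B : Set Plane := Metric.closedBall 0 n with hB
  have hBcpt : IsCompact B := isCompact_closedBall _ _
  have hsplit : u '' (S ∩ B) ⊆ u '' {x ∈ B | fderiv ℝ u x = 0 ∧ fderiv ℝ (fderiv ℝ u) x ≠ 0} ∪
      u '' {x ∈ B | fderiv ℝ u x = 0 ∧ fderiv ℝ (fderiv ℝ u) x = 0} := by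
    rw [← Set.image_union]
    refine Set.image_mono fun x hx => ?_
    by_cases h : fderiv ℝ (fderiv ℝ u) x = 0
    · exact Or.inr ⟨hx.2, hx.1, h⟩
    · exact Or.inl ⟨hx.2, hx.1, h⟩
  refine measure_mono_null hsplit (measure_union_null ?_ ?_)
  · obtain ⟨C, hC⟩ := hBcpt.exists_bound_of_continuousOn hnorm.continuousOn
    replace hC : ∀ x ∈ B, ‖fderiv ℝ (fderiv ℝ u) x‖ ≤ C := fun x hx =>
      (le_abs_self _).trans (hC x hx)
    have h1 := volume_image_le_of_critical hu (convex_closedBall 0 (n : ℝ)) (C := C.toNNReal)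
      (fun x hx => (hC x hx).trans (Real.le_coe_toNNReal C))
      (s := {x ∈ B | fderiv ℝ u x = 0 ∧ fderiv ℝ (fderiv ℝ u) x ≠ 0})
      (fun x hx => hx.2.1) (fun x hx => hx.1)
    rw [hac (measure_mono_null (fun x hx => hx.2) (ae_fderiv_fderiv_eq_zero hu)), mul_zero] at h1
    exact nonpos_iff_eq_zero.1 h1
  · set T := {x ∈ B | fderiv ℝ u x = 0 ∧ fderiv ℝ (fderiv ℝ u) x = 0} with hT
    have hTm : MeasurableSet T := (hBcpt.isClosed.inter
      (hSc.inter (isClosed_singleton.preimage hddu))).measurableSet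
    have hfin : μH[2] T ≠ ∞ := by
      have : (μH[2] : Measure Plane).IsAddHaarMeasure :=
        inferInstanceAs (μH[(2 : ℕ)] : Measure (EuclideanSpace ℝ (Fin 2))).IsAddHaarMeasure
      exact ((measure_mono fun x hx => hx.1).trans_lt hBcpt.measure_lt_top).ne
    have hε : ∀ ε : ℝ≥0, 0 < ε → volume (u '' T) ≤ ε * μH[2] T := by
      intro ε hε
      have hloc : ∀ x ∈ T, ∃ r > 0, ∀ y ∈ Metric.ball x r, ‖fderiv ℝ (fderiv ℝ u) y‖ ≤ ε := by
        intro x hx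
        have : ∀ᶠ y in 𝓝 x, ‖fderiv ℝ (fderiv ℝ u) y‖ < ε :=
          hnorm.continuousAt.eventually_lt_const
            (show ‖fderiv ℝ (fderiv ℝ u) x‖ < ε by
              rw [hx.2.2]
              exact (norm_zero (E := Plane →L[ℝ] Plane →L[ℝ] ℝ)).trans_lt (by exact_mod_cast hε))
        obtain ⟨r, hr, h⟩ := Metric.eventually_nhds_iff_ball.1 this
        exact ⟨r, hr, fun y hy => (h y hy).le⟩
      choose! r hr hbd using hloc
      obtain ⟨t, htT, htc, hTt⟩ := TopologicalSpace.countable_cover_nhdsWithin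
        (s := T) (f := fun x => Metric.ball x (r x))
        fun x hx => mem_nhdsWithin_of_mem_nhds (Metric.ball_mem_nhds x (hr x hx))
      rcases t.eq_empty_or_nonempty with rfl | hne
      · have : T = ∅ := by simpa using hTt
        simp [this]
      obtain ⟨e, rfl⟩ := htc.exists_eq_range hne
      let D : ℕ → Set Plane := disjointed fun k => Metric.ball (e k) (r (e k))
      have hDm : ∀ k, MeasurableSet (D k) :=
        fun k => MeasurableSet.disjointed (fun _ => Metric.isOpen_ball.measurableSet) k
      have hTD : T = ⋃ k, T ∩ D k := by
        rw [← Set.inter_iUnion, iUnion_disjointed, Set.left_eq_inter]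
        simpa using hTt
      calc volume (u '' T) ≤ ∑' k, volume (u '' (T ∩ D k)) := by
            conv_lhs => rw [hTD, Set.image_iUnion]
            exact measure_iUnion_le _
        _ ≤ ∑' k, ε * μH[2] (T ∩ D k) := ENNReal.tsum_le_tsum fun k =>
            volume_image_le_of_critical hu (convex_ball (e k) (r (e k)))
              (hbd _ (htT ⟨k, rfl⟩)) (fun x hx => hx.1.2.1)
              (fun x hx => disjointed_subset _ k hx.2)
        _ = ε * μH[2] T := by
            rw [ENNReal.tsum_mul_left, ← measure_iUnion, ← hTD]
            · exact fun i j hij => ((disjoint_disjointed _) hij).mono Set.inter_subset_right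
                Set.inter_subset_right
            · exact fun k => hTm.inter (hDm k)
    by_contra hpos
    obtain ⟨ε, hε0, hlt⟩ := ENNReal.exists_nnreal_pos_mul_lt hfin hpos
    exact absurd (hε ε hε0) (not_le.2 hlt)

/-- A `C²` function on the plane is constant on every connected set of critical points. -/
theorem IsPreconnected.eq_of_critical {u : Plane → ℝ} (hu : ContDiff ℝ 2 u) {S : Set Plane}
    (hSc : IsPreconnected S) (hS : ∀ x ∈ S, fderiv ℝ u x = 0) {x y : Plane} (hx : x ∈ S)
    (hy : y ∈ S) : u x = u y := by
  have himg := (hSc.image u hu.continuous.continuousOn).ordConnected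
  have hle : ∀ a ∈ S, ∀ b ∈ S, u b ≤ u a := by
    intro a ha b hb
    have h0 : volume (Set.Icc (u a) (u b)) = 0 :=
      measure_mono_null ((himg.out ⟨a, ha, rfl⟩ ⟨b, hb, rfl⟩).trans (Set.image_mono hS))
        (volume_image_critical_eq_zero hu)
    simpa using h0
  exact le_antisymm (hle y hy x hx) (hle x hx y hy)

/-! ### Unicoherence of simply connected spaces -/

/-- Unicoherence of a simply connected space: if two closed connected sets cover the space, then
their intersection is connected. If the intersection splits into `P` and `Q`, take `g` with `g = 0`
on `P` and `g = 1` on `Q`. The circle-valued map given by `exp (iπg)` on `A` and `exp (-iπg)` on `B`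
has a real lift, whose increment from `P` to `Q` is `π` along `A` and `-π` along `B`. -/
theorem IsPreconnected.inter_of_union_eq_univ {X : Type*} [TopologicalSpace X]
    [SimplyConnectedSpace X] [LocallyPathConnectedSpace X] [NormalSpace X] {A B : Set X}
    (hA : IsClosed A) (hB : IsClosed B) (hAc : IsPreconnected A) (hBc : IsPreconnected B)
    (hAB : A ∪ B = Set.univ) : IsPreconnected (A ∩ B) := by
  classical
  rw [isPreconnected_iff_subset_of_fully_disjoint_closed (hA.inter hB)]
  intro P Q hP hQ hsub hdisj
  by_contra! hcon
  obtain ⟨a, ⟨haA, haB⟩, haP⟩ := Set.not_subset.1 hcon.1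
  obtain ⟨b, ⟨hbA, hbB⟩, hbQ⟩ := Set.not_subset.1 hcon.2
  have haQ : a ∈ Q := (hsub ⟨haA, haB⟩).resolve_left haP
  have hbP : b ∈ P := (hsub ⟨hbA, hbB⟩).resolve_right hbQ
  obtain ⟨g, hg0, hg1, -⟩ := exists_continuous_zero_one_of_isClosed hP hQ hdisj
  let h : X → Circle := fun x =>
    if x ∈ A then Circle.exp (Real.pi * g x) else Circle.exp (-(Real.pi * g x))
  have hhA : ∀ x ∈ A, h x = Circle.exp (Real.pi * g x) := fun x hx => if_pos hx
  have hhB : ∀ x ∈ B, h x = Circle.exp (-(Real.pi * g x)) := by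
    intro x hx
    by_cases hxA : x ∈ A
    · rw [hhA x hxA]
      rcases hsub ⟨hxA, hx⟩ with hx' | hx'
      · simp [hg0 hx']
      · -- `exp (iπ) = exp (-iπ)`
        rw [show g x = 1 from hg1 hx', Circle.exp_eq_exp]
        exact ⟨1, by push_cast; ring⟩
    · exact if_neg hxA
  have hcont : Continuous h := by
    rw [← continuousOn_univ, ← hAB]
    refine ContinuousOn.union_of_isClosed ?_ ?_ hA hB
    · exact ContinuousOn.congr (Continuous.continuousOn (by fun_prop)) hhA
    · exact ContinuousOn.congr (Continuous.continuousOn (by fun_prop)) hhB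
  obtain ⟨F, ⟨-, hF⟩, -⟩ := Circle.isCoveringMap_exp.existsUnique_continuousMap_lifts ⟨h, hcont⟩ a
    (Real.pi * g a) (hhA a haA).symm
  have hF' : ∀ x, Circle.exp (F x) = h x := fun x => congrFun hF x
  have key : ∀ C : Set X, IsPreconnected C → ∀ G : X → ℝ, Continuous G →
      (∀ x ∈ C, h x = Circle.exp (G x)) → ∀ x ∈ C, ∀ y ∈ C, F x - G x = F y - G y := by
    intro C hC G hG hhG x hx y hy
    refine hC.constant_of_mapsTo (T := (AddSubgroup.zmultiples (2 * Real.pi) : Set ℝ))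
      (f := fun x => F x - G x)
      ⟨inferInstanceAs (DiscreteTopology (AddSubgroup.zmultiples (2 * Real.pi)))⟩ (by fun_prop) ?_ hx hy
    intro z hz
    have := (hF' z).trans (hhG z hz)
    obtain ⟨m, hm⟩ := Circle.exp_eq_exp.1 this
    exact ⟨m, by simp [hm]⟩
  have h1 := key A hAc (fun x => Real.pi * g x) (by fun_prop) hhA a haA b hbA
  have h2 := key B hBc (fun x => -(Real.pi * g x)) (by fun_prop) hhB a haB b hbB
  have e1 : g a = 1 := hg1 haQ
  have e0 : g b = 0 := hg0 hbP
  simp only [e1, e0] at h1 h2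
  linarith [Real.pi_pos]

/-! ### Maximum principle and behaviour at infinity -/

/-- The oscillation of `u` is arbitrarily small on arbitrarily large circles centred at the
origin. -/
def SmallOscillation (u : Plane → ℝ) : Prop :=
  ∀ ε > 0, ∀ R₀ : ℝ, ∃ R > R₀, ∀ x y, ‖x‖ = R → ‖y‖ = R → |u x - u y| < ε

namespace SmallOscillation

variable {u : Plane → ℝ}

lemma neg_add (h : SmallOscillation u) (c : ℝ) : SmallOscillation fun x => - u x + c := by
  intro ε hε R₀
  obtain ⟨R, hR, h'⟩ := h ε hε R₀
  exact ⟨R, hR, fun x y hx hy => by simpa [abs_sub_comm, neg_add_eq_sub] using h' y x hy hx⟩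

lemma add_const (h : SmallOscillation u) (c : ℝ) : SmallOscillation fun x => u x + c := by
  intro ε hε R₀
  obtain ⟨R, hR, h'⟩ := h ε hε R₀
  exact ⟨R, hR, fun x y hx hy => by simpa using h' x y hx hy⟩

end SmallOscillation

/-- The maximum of a function over a compact set is attained at a critical point or on the
boundary. -/
lemma IsCompact.exists_le_critical_or_frontier {u : Plane → ℝ} (hu : Continuous u) {K : Set Plane}
    (hK : IsCompact K) {x : Plane} (hx : x ∈ K) :
    ∃ y ∈ K, u x ≤ u y ∧ (fderiv ℝ u y = 0 ∨ y ∉ interior K) := by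
  obtain ⟨y, hy, hmax⟩ := hK.exists_isMaxOn ⟨x, hx⟩ hu.continuousOn
  refine ⟨y, hy, hmax hx, ?_⟩
  by_cases h : y ∈ interior K
  · exact Or.inl (hmax.isLocalMax (mem_interior_iff_mem_nhds.1 h)).fderiv_eq_zero
  · exact Or.inr h

lemma exists_sphere_ge {u : Plane → ℝ} (hu : Continuous u) {R : ℝ} {x : Plane} (hx : ‖x‖ < R)
    (hcrit : ∀ y, fderiv ℝ u y = 0 → u y < u x) : ∃ y, ‖y‖ = R ∧ u x ≤ u y := by
  obtain ⟨y, hyK, hxy, h⟩ := (isCompact_closedBall (0 : Plane) R).exists_le_critical_or_frontier hu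
    (x := x) (by simpa using hx.le)
  rcases h with h | h
  · exact absurd (hcrit y h) (not_lt.2 hxy)
  · rw [interior_closedBall _ ((norm_nonneg x).trans_lt hx).ne'] at h
    exact ⟨y, le_antisymm (by simpa using hyK) (by simpa using h), hxy⟩

lemma exists_sphere_le {u : Plane → ℝ} (hu : Continuous u) {R : ℝ} {x : Plane} (hx : ‖x‖ < R)
    (hcrit : ∀ y, fderiv ℝ u y = 0 → u x < u y) : ∃ y, ‖y‖ = R ∧ u y ≤ u x := by
  obtain ⟨y, hy, h⟩ := exists_sphere_ge (u := fun z => - u z) hu.neg hx (fun y hy => by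
    rw [fderiv_fun_neg, neg_eq_zero] at hy
    exact neg_lt_neg (hcrit y hy))
  exact ⟨y, hy, neg_le_neg_iff.1 h⟩

lemma SmallOscillation.le_of_forall_critical {u : Plane → ℝ} (hosc : SmallOscillation u)
    (hu : Continuous u) {x y : Plane} (hx : ∀ z, fderiv ℝ u z = 0 → u z < u x)
    (hy : ∀ z, fderiv ℝ u z = 0 → u y < u z) : u x ≤ u y := by
  by_contra! hlt
  obtain ⟨R, hR, h⟩ := hosc _ (sub_pos.2 hlt) (max ‖x‖ ‖y‖)
  obtain ⟨a, ha, hxa⟩ := exists_sphere_ge hu ((le_max_left _ _).trans_lt hR) hx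
  obtain ⟨b, hb, hyb⟩ := exists_sphere_le hu ((le_max_right _ _).trans_lt hR) hy
  have := (le_abs_self _).trans_lt (h a b ha hb)
  linarith

/-- Without critical points, the oscillation on a disc is bounded by that on its boundary circle,
so that the function is constant. -/
theorem SmallOscillation.exists_critical {u : Plane → ℝ} (hosc : SmallOscillation u)
    (hu : Continuous u) : ∃ x, fderiv ℝ u x = 0 := by
  by_contra! hcon
  have hle : ∀ x y, u x ≤ u y := fun x y =>
    hosc.le_of_forall_critical hu (fun z hz => absurd hz (hcon z)) (fun z hz => absurd hz (hcon z))
  have : u = fun _ => u 0 := funext fun x => le_antisymm (hle _ _) (hle _ _)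
  exact hcon 0 (by rw [this]; simp)

/-- A function whose only possible critical value is `c` lies on one side of `c`: otherwise it would
take values both above and below `c` on every large circle, a fixed distance apart. -/
theorem SmallOscillation.le_or_ge {u : Plane → ℝ} (hosc : SmallOscillation u) (hu : Continuous u)
    {c : ℝ} (hc : ∀ x, fderiv ℝ u x = 0 → u x = c) : (∀ x, u x ≤ c) ∨ (∀ x, c ≤ u x) := by
  by_contra! hcon
  obtain ⟨⟨x, hx⟩, ⟨y, hy⟩⟩ := hcon
  have := hosc.le_of_forall_critical hu (x := x) (y := y) (fun z hz => by rwa [hc z hz])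
    (fun z hz => by rwa [hc z hz])
  linarith

lemma isPreconnected_setOf_lt_norm {R : ℝ} (hR : 0 ≤ R) :
    IsPreconnected {x : Plane | R < ‖x‖} := by
  have hrank : 1 < Module.rank ℝ Plane := by
    rw [← Module.finrank_eq_rank, finrank_euclideanSpace_fin]
    norm_num
  have h := (isPreconnected_Ioi (a := R)).prod (isPreconnected_sphere hrank (0 : Plane) 1)
  convert! h.image (fun p : ℝ × Plane => p.1 • p.2) (by fun_prop)
  ext x
  constructor
  · intro hx
    have hx0 : ‖x‖ ≠ 0 := (hR.trans_lt hx).ne'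
    exact ⟨(‖x‖, ‖x‖⁻¹ • x), ⟨hx, by simp [norm_smul, hx0]⟩, by simp [smul_smul, hx0]⟩
  · rintro ⟨⟨r, y⟩, ⟨hr, hy⟩, rfl⟩
    have hr' : R < r := hr
    have hy' : ‖y‖ = 1 := by simpa using hy
    simpa [norm_smul, hy', abs_of_nonneg (hR.trans hr'.le)] using hr'

/-- A nonconstant `C²` function on the plane, of small oscillation on large circles, whose critical
set is connected and which attains its maximum `1` at each critical point. -/
structure IsPeaked (u : Plane → ℝ) : Prop where
  contDiff : ContDiff ℝ 2 u
  smallOscillation : SmallOscillation u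
  le_one : ∀ x, u x ≤ 1
  eq_one : ∀ x, fderiv ℝ u x = 0 → u x = 1
  isPreconnected : IsPreconnected {x | fderiv ℝ u x = 0}
  exists_lt : ∃ x, u x < 1

namespace IsPeaked

variable {u : Plane → ℝ}

lemma continuous (h : IsPeaked u) : Continuous u := h.contDiff.continuous

lemma fderiv_eq_zero_iff (h : IsPeaked u) {x : Plane} : fderiv ℝ u x = 0 ↔ u x = 1 := by
  refine ⟨h.eq_one x, fun hx => IsLocalExtr.fderiv_eq_zero (Or.inr ?_)⟩
  exact Eventually.of_forall fun y => hx ▸ h.le_one y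

lemma isPreconnected_one (h : IsPeaked u) : IsPreconnected {x | u x = 1} := by
  simpa only [h.fderiv_eq_zero_iff] using h.isPreconnected

lemma exists_eq_one (h : IsPeaked u) : ∃ x, u x = 1 := by
  obtain ⟨x, hx⟩ := h.smallOscillation.exists_critical h.continuous
  exact ⟨x, h.eq_one x hx⟩

lemma exists_sphere_lt (h : IsPeaked u) {x₀ : Plane} (hx₀ : u x₀ < 1) {s : ℝ} (hs : u x₀ < s)
    (R₀ : ℝ) : ∃ R > R₀, ∀ x, ‖x‖ = R → u x < s := by
  obtain ⟨R, hR, hosc⟩ := h.smallOscillation _ (sub_pos.2 hs) (max R₀ ‖x₀‖)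
  obtain ⟨y, hy, hle⟩ := exists_sphere_le h.continuous ((le_max_right _ _).trans_lt hR)
    (fun z hz => by rwa [h.eq_one z hz])
  refine ⟨R, (le_max_left _ _).trans_lt hR, fun x hx => ?_⟩
  have := (le_abs_self _).trans_lt (hosc x y hx hy)
  linarith

/-- The set where the maximum is attained is bounded, being connected and missing large circles. -/
lemma exists_forall_norm_lt (h : IsPeaked u) : ∃ R₀, ∀ x, u x = 1 → ‖x‖ < R₀ := by
  obtain ⟨x₀, hx₀⟩ := h.exists_lt
  obtain ⟨z, hz⟩ := h.exists_eq_one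
  obtain ⟨R, hR, hlt⟩ := h.exists_sphere_lt hx₀ hx₀ ‖z‖
  refine ⟨R, fun x hx => ?_⟩
  by_contra! hle
  obtain ⟨y, hy, hyR⟩ :=
    (h.isPreconnected_one.image norm continuous_norm.continuousOn).ordConnected.out
      ⟨z, hz, rfl⟩ ⟨x, hx, rfl⟩ ⟨hR.le, hle⟩
  exact (hlt y hyR).ne hy

/-- The upper limit of `u` at infinity is at most its infimum: the maximum of `u` over an annulus
between two large circles is attained on one of them, as the critical set is bounded. -/
lemma eventually_lt (h : IsPeaked u) {x₀ : Plane} {s : ℝ} (hs : u x₀ < s) :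
    ∀ᶠ x in cocompact Plane, u x < s := by
  by_cases hs1 : 1 < s
  · exact Eventually.of_forall fun x => (h.le_one x).trans_lt hs1
  have hx₀ : u x₀ < 1 := hs.trans_le (not_lt.1 hs1)
  obtain ⟨R₀, hR₀⟩ := h.exists_forall_norm_lt
  obtain ⟨R, hR, hlt⟩ := h.exists_sphere_lt hx₀ hs (max R₀ 0)
  have hRR₀ := (le_max_left _ _).trans_lt hR
  have hR0 : 0 < R := (le_max_right _ _).trans_lt hR
  filter_upwards [(isCompact_closedBall (0 : Plane) R).compl_mem_cocompact] with x hx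
  have hxR : R < ‖x‖ := by simpa using hx
  obtain ⟨R', hR', hlt'⟩ := h.exists_sphere_lt hx₀ hs ‖x‖
  have hK : IsCompact (Metric.closedBall (0 : Plane) R' \ Metric.ball 0 R) :=
    (isCompact_closedBall _ _).diff Metric.isOpen_ball
  obtain ⟨y, hy, hxy, hy'⟩ := hK.exists_le_critical_or_frontier h.continuous (x := x)
    ⟨by simpa using hR'.le, by simpa using hxR.le⟩
  refine hxy.trans_lt ?_
  have hy1 : ‖y‖ ≤ R' := by simpa using hy.1
  have hy2 : R ≤ ‖y‖ := by simpa using hy.2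
  rcases hy' with hy' | hy'
  · exact absurd (hR₀ y (h.eq_one y hy')) (not_lt.2 (hRR₀.le.trans hy2))
  · rcases hy1.eq_or_lt with e1 | l1
    · exact hlt' y e1
    rcases hy2.eq_or_lt with e2 | l2
    · exact hlt y e2.symm
    refine absurd (mem_interior_iff_mem_nhds.2 ?_) hy'
    filter_upwards [continuous_norm.continuousAt.eventually_lt_const l1,
      continuous_norm.continuousAt.eventually_const_lt l2] with z hz1 hz2
    exact ⟨by simpa using hz1.le, by simpa using hz2.le⟩

lemma not_isMinimum (h : IsPeaked u) (x : Plane) : ∃ y, u y < u x := by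
  by_contra! hcon
  obtain ⟨x₀, hx₀⟩ := h.exists_lt
  have : fderiv ℝ u x = 0 := IsLocalExtr.fderiv_eq_zero (Or.inl (Eventually.of_forall hcon))
  linarith [hcon x₀, h.eq_one x this]

lemma isCompact_ge (h : IsPeaked u) {x₀ : Plane} {t : ℝ} (ht : u x₀ < t) :
    IsCompact {x | t ≤ u x} := by
  obtain ⟨K, hK, hKt⟩ := mem_cocompact.1 (h.eventually_lt ht)
  refine hK.of_isClosed_subset (isClosed_le continuous_const h.continuous) fun x hx => ?_
  by_contra hxK
  exact (show u x < t from hKt hxK).not_ge hx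

/-- A part of `{t ≤ u}` away from the critical set would contain a local maximum of `u`. -/
lemma isPreconnected_ge (h : IsPeaked u) {x₀ : Plane} {t : ℝ} (ht : u x₀ < t) (ht1 : t < 1) :
    IsPreconnected {x | t ≤ u x} := by
  rw [isPreconnected_iff_subset_of_fully_disjoint_closed
    (isClosed_le continuous_const h.continuous)]
  have key : ∀ P Q : Set Plane, IsClosed P → IsClosed Q → {x | t ≤ u x} ⊆ P ∪ Q → Disjoint P Q →
      {x | u x = 1} ⊆ P → {x | t ≤ u x} ⊆ P := by
    intro P Q hP hQ hsub hdisj h1 x hx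
    by_contra hxP
    have hxQ : x ∈ Q := (hsub hx).resolve_left hxP
    obtain ⟨q, ⟨hq, hqQ⟩, hmax⟩ := ((h.isCompact_ge ht).inter_right hQ).exists_isMaxOn
      ⟨x, hx, hxQ⟩ h.continuous.continuousOn
    have hqP : q ∉ P := fun hqP => Set.disjoint_left.1 hdisj hqP hqQ
    have hloc : IsLocalMax u q := by
      filter_upwards [hP.isOpen_compl.mem_nhds hqP] with y hy
      by_cases hyt : t ≤ u y
      · exact hmax ⟨hyt, (hsub hyt).resolve_left hy⟩
      · exact (not_le.1 hyt).le.trans hq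
    exact hqP (h1 (h.eq_one q hloc.fderiv_eq_zero))
  intro P Q hP hQ hsub hdisj
  have hS := (isPreconnected_iff_subset_of_fully_disjoint_closed
    (isClosed_eq h.continuous continuous_const)).1 h.isPreconnected_one P Q hP hQ
    (Set.Subset.trans (fun x (hx : u x = 1) => show t ≤ u x by rw [hx]; exact ht1.le) hsub) hdisj
  rcases hS with hS | hS
  · exact Or.inl (key P Q hP hQ hsub hdisj hS)
  · exact Or.inr (key Q P hQ hP (by rwa [Set.union_comm]) hdisj.symm hS)

/-- A bounded part of `{u ≤ t}` would contain a local minimum of `u`, a critical point at which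
`u ≤ t < 1`. -/
lemma isPreconnected_le (h : IsPeaked u) {x₀ : Plane} {t : ℝ} (ht : u x₀ < t) (ht1 : t < 1) :
    IsPreconnected {x | u x ≤ t} := by
  rw [isPreconnected_iff_subset_of_fully_disjoint_closed
    (isClosed_le h.continuous continuous_const)]
  obtain ⟨R, hR0, hR⟩ : ∃ R : ℝ, 0 ≤ R ∧ ∀ x : Plane, R < ‖x‖ → u x ≤ t := by
    obtain ⟨R, hR0, hR⟩ := (h.isCompact_ge ht).isBounded.exists_pos_norm_le
    exact ⟨R, hR0.le, fun x hx => by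
      by_contra! hlt
      exact absurd (hR x hlt.le) (not_le.2 hx)⟩
  have key : ∀ P Q : Set Plane, IsClosed P → IsClosed Q → {x | u x ≤ t} ⊆ P ∪ Q → Disjoint P Q →
      {x : Plane | R < ‖x‖} ⊆ P → {x | u x ≤ t} ⊆ P := by
    intro P Q hP hQ hsub hdisj h1 x hx
    by_contra hxP
    have hxQ : x ∈ Q := (hsub hx).resolve_left hxP
    have hcpt : IsCompact ({x | u x ≤ t} ∩ Q) := by
      refine (isCompact_closedBall (0 : Plane) R).of_isClosed_subset
        ((isClosed_le h.continuous continuous_const).inter hQ) fun y hy => ?_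
      by_contra hyR
      exact Set.disjoint_left.1 hdisj (h1 (by simpa using hyR)) hy.2
    obtain ⟨q, ⟨hq, hqQ⟩, hmin⟩ := hcpt.exists_isMinOn ⟨x, hx, hxQ⟩ h.continuous.continuousOn
    have hqP : q ∉ P := fun hqP => Set.disjoint_left.1 hdisj hqP hqQ
    have hloc : IsLocalMin u q := by
      filter_upwards [hP.isOpen_compl.mem_nhds hqP] with y hy
      by_cases hyt : u y ≤ t
      · exact hmin ⟨hyt, (hsub hyt).resolve_left hy⟩
      · exact le_trans hq (not_le.1 hyt).le
    have := h.eq_one q hloc.fderiv_eq_zero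
    have hq' : u q ≤ t := hq
    linarith
  have hext := isPreconnected_setOf_lt_norm hR0
  intro P Q hP hQ hsub hdisj
  have hd : {x : Plane | R < ‖x‖} ⊆ P ∨ {x : Plane | R < ‖x‖} ⊆ Q :=
    isPreconnected_iff_subset_of_disjoint_closed.1 hext P Q hP hQ
      (Set.Subset.trans (fun x hx => hR x hx) hsub) (by rw [hdisj.inter_eq, Set.inter_empty])
  rcases hd with hS | hS
  · exact Or.inl (key P Q hP hQ hsub hdisj hS)
  · exact Or.inr (key Q P hQ hP (by rwa [Set.union_comm]) hdisj.symm hS)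

end IsPeaked

/-! ### Local dependence of the vorticity on the stream function -/

/-- If `∂₁G = 0` and `∂₂G = w` on a rectangle, then `w` does not depend on the first coordinate. No
second derivative of `G` is needed. -/
lemma eq_of_hasFDerivAt_smul_snd {G w : ℝ × ℝ → ℝ} {I J : Set ℝ} (hI : Convex ℝ I) (hIo : IsOpen I)
    (hJo : IsOpen J)
    (hG : ∀ p ∈ I ×ˢ J, HasFDerivAt G (w p • ContinuousLinearMap.snd ℝ ℝ ℝ) p) {a b t : ℝ}
    (ha : a ∈ I) (hb : b ∈ I) (ht : t ∈ J) : w (a, t) = w (b, t) := by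
  have hconst : ∀ s ∈ J, G (a, s) = G (b, s) := by
    intro s hs
    have hder : ∀ c ∈ I, HasFDerivAt (fun c => G (c, s)) (0 : ℝ →L[ℝ] ℝ) c := by
      intro c hc
      refine ((hG (c, s) ⟨hc, hs⟩).comp c (hasFDerivAt_prodMk_left c s)).congr_fderiv ?_
      ext
      simp
    exact hI.is_const_of_fderivWithin_eq_zero (𝕜 := ℝ) (f := fun c => G (c, s))
      (fun c hc => (hder c hc).differentiableAt.differentiableWithinAt)
      (fun c hc => (hder c hc).hasFDerivWithinAt.fderivWithin (hIo.uniqueDiffWithinAt hc)) ha hb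
  have hder : ∀ c ∈ I, HasDerivAt (fun s => G (c, s)) (w (c, t)) t := by
    intro c hc
    have := (hG (c, t) ⟨hc, ht⟩).comp_hasDerivAt t ((hasDerivAt_const t c).prodMk (hasDerivAt_id t))
    exact this.congr_deriv (by simp)
  refine (hder a ha).unique ((hder b hb).congr_of_eventuallyEq ?_)
  filter_upwards [hJo.mem_nhds ht] with s hs using hconst s hs

/-- A nonzero linear form on the plane is the second coordinate of a linear isomorphism
onto `ℝ × ℝ`. -/
lemma exists_equiv_prod {T : Plane →L[ℝ] ℝ} (hT : T ≠ 0) :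
    ∃ (l : Plane →L[ℝ] ℝ) (e : Plane ≃L[ℝ] ℝ × ℝ), (e : Plane →L[ℝ] ℝ × ℝ) = l.prod T := by
  set α := T (EuclideanSpace.single 0 1) with hα
  set β := T (EuclideanSpace.single 1 1) with hβ
  let l : Plane →L[ℝ] ℝ := perpForm !₂[α, β]
  have hpos : 0 < α ^ 2 + β ^ 2 := by
    by_contra! hle
    refine hT (ContinuousLinearMap.ext fun h => ?_)
    have h1 : α = 0 := by nlinarith [sq_nonneg α, sq_nonneg β]
    have h2 : β = 0 := by nlinarith [sq_nonneg α, sq_nonneg β]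
    rw [ContinuousLinearMap.apply_eq_plane, ← hα, ← hβ, h1, h2]
    simp
  have hinj : Function.Injective (l.prod T) := by
    refine (injective_iff_map_eq_zero (l.prod T)).2 fun h hh => ?_
    obtain ⟨h1, h2⟩ := Prod.mk.inj hh
    have e1 : β * h 0 - α * h 1 = 0 := by simpa [l] using h1
    have e2 : h 0 * α + h 1 * β = 0 := by
      simpa [← hα, ← hβ] using (ContinuousLinearMap.apply_eq_plane T h).symm.trans h2
    ext i
    fin_cases i
    · have : (α ^ 2 + β ^ 2) * h 0 = 0 := by linear_combination β * e1 + α * e2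
      simpa [hpos.ne'] using this
    · have : (α ^ 2 + β ^ 2) * h 1 = 0 := by linear_combination -α * e1 + β * e2
      simpa [hpos.ne'] using this
  let e := (LinearMap.linearEquivOfInjective (l.prod T : Plane →ₗ[ℝ] ℝ × ℝ) hinj
    (by simp)).toContinuousLinearEquiv
  exact ⟨l, e, by ext1 h; rfl⟩

/-- If `∇H = ω ∇u`, then near a regular point of `u`, `ω` is a function of `u`. -/
theorem eventually_eq_of_hasFDerivAt_smul {u H ω : Plane → ℝ} (hu : ContDiff ℝ 2 u)
    (hH : ∀ x, HasFDerivAt H (ω x • fderiv ℝ u x) x) {a : Plane} (ha : fderiv ℝ u a ≠ 0) :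
    ∃ N ∈ 𝓝 a, ∀ y ∈ N, ∀ z ∈ N, u y = u z → ω y = ω z := by
  obtain ⟨l, e, he⟩ := exists_equiv_prod ha
  -- In the chart `Φ = (l, u)`, the Bernoulli relation reads `dG = ω dt` for `G = H ∘ Φ⁻¹`.
  set Φ : Plane → ℝ × ℝ := fun x => (l x, u x) with hΦ
  have hΦc : ContDiffAt ℝ 2 Φ a := (l.contDiff.prodMk hu).contDiffAt
  have hΦ' : HasFDerivAt Φ (e : Plane →L[ℝ] ℝ × ℝ) a := by
    rw [he]
    exact l.hasFDerivAt.prodMk (hu.differentiable (by norm_num) a).hasFDerivAt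
  set P := hΦc.toOpenPartialHomeomorph Φ hΦ' (by norm_num)
  set Ψ : ℝ × ℝ → Plane := ⇑P.symm with hΨ
  have hΨc : ContDiffAt ℝ 2 Ψ (Φ a) := hΦc.to_localInverse hΦ' (by norm_num)
  have hev : ∀ᶠ b in 𝓝 (Φ a), DifferentiableAt ℝ Ψ b ∧ b ∈ P.target := by
    refine Eventually.and ?_ (P.open_target.mem_nhds
      (hΦc.image_mem_toOpenPartialHomeomorph_target hΦ' (by norm_num)))
    filter_upwards [hΨc.eventually (by simp)] with b hb using hb.differentiableAt (by norm_num)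
  obtain ⟨r, hr, hball⟩ := Metric.eventually_nhds_iff_ball.1 hev
  have hG : ∀ p ∈ Metric.ball (Φ a).1 r ×ˢ Metric.ball (Φ a).2 r,
      HasFDerivAt (fun b => H (Ψ b)) (ω (Ψ p) • ContinuousLinearMap.snd ℝ ℝ ℝ) p := by
    intro p hp
    rw [ball_prod_same] at hp
    have hd := (hball p hp).1.hasFDerivAt
    have h1 : HasFDerivAt (fun b => u (Ψ b)) ((fderiv ℝ u (Ψ p)).comp (fderiv ℝ Ψ p)) p :=
      (hu.differentiable (by norm_num) _).hasFDerivAt.comp p hd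
    have h2 : (fun b => u (Ψ b)) =ᶠ[𝓝 p] Prod.snd := by
      filter_upwards [Metric.isOpen_ball.mem_nhds hp] with b hb
      exact congrArg Prod.snd (P.right_inv (hball b hb).2)
    have h3 : (fderiv ℝ u (Ψ p)).comp (fderiv ℝ Ψ p) = ContinuousLinearMap.snd ℝ ℝ ℝ :=
      h1.unique (hasFDerivAt_snd.congr_of_eventuallyEq h2)
    refine ((hH (Ψ p)).comp p hd).congr_fderiv ?_
    rw [ContinuousLinearMap.smul_comp, h3]
  refine ⟨P.source ∩ Φ ⁻¹' (Metric.ball (Φ a) r), inter_mem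
    (P.open_source.mem_nhds (hΦc.mem_toOpenPartialHomeomorph_source hΦ' (by norm_num)))
    (hΦc.continuousAt.preimage_mem_nhds (Metric.ball_mem_nhds _ hr)), ?_⟩
  rintro y ⟨hyP, hyb⟩ z ⟨hzP, hzb⟩ hyz
  have hyb' : Φ y ∈ Metric.ball (Φ a).1 r ×ˢ Metric.ball (Φ a).2 r := by
    rw [ball_prod_same]; exact hyb
  have hzb' : Φ z ∈ Metric.ball (Φ a).1 r ×ˢ Metric.ball (Φ a).2 r := by
    rw [ball_prod_same]; exact hzb
  have key := eq_of_hasFDerivAt_smul_snd (w := fun p => ω (Ψ p)) (convex_ball (Φ a).1 r)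
    Metric.isOpen_ball Metric.isOpen_ball hG hyb'.1 hzb'.1 hzb'.2
  have e1 : Ψ ((Φ y).1, (Φ z).2) = y := by
    rw [show ((Φ y).1, (Φ z).2) = P y from Prod.ext rfl hyz.symm]
    exact P.left_inv hyP
  have e2 : Ψ ((Φ z).1, (Φ z).2) = z := P.left_inv hzP
  simpa only [e1, e2] using key

/-! ### Global dependence of the vorticity on the stream function -/

namespace IsPeaked

variable {u H : Plane → ℝ}

lemma isPreconnected_level (h : IsPeaked u) {t : ℝ} {x₀ : Plane} (hx₀ : u x₀ = t) (ht : t < 1) :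
    IsPreconnected {x | u x = t} := by
  obtain ⟨y, hy⟩ := h.not_isMinimum x₀
  rw [hx₀] at hy
  convert! (h.isPreconnected_ge hy ht).inter_of_union_eq_univ
    (isClosed_le continuous_const h.continuous) (isClosed_le h.continuous continuous_const)
    (h.isPreconnected_le hy ht) ?_ using 1
  · ext x
    exact ⟨fun hx => ⟨hx.ge, hx.le⟩, fun hx => le_antisymm hx.2 hx.1⟩
  · exact Set.eq_univ_of_forall fun x => le_total t (u x)

lemma continuous_laplacian (h : IsPeaked u) : Continuous (Laplacian.laplacian u) := by
  have hc : Continuous (fderiv ℝ (fderiv ℝ u)) :=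
    (h.contDiff.fderiv_right (m := 1) (by norm_num)).continuous_fderiv (by norm_num)
  rw [funext (laplacian_eq_sum u)]
  exact continuous_finsetSum _ fun i _ =>
    (hc.clm_apply continuous_const).clm_apply continuous_const

/-- The Laplacian is locally constant on a level set below the maximum, and that set is
connected. -/
lemma laplacian_eq_of_lt (h : IsPeaked u)
    (hH : ∀ x, HasFDerivAt H (Laplacian.laplacian u x • fderiv ℝ u x) x) {x y : Plane}
    (hx : u x < 1) (hxy : u x = u y) : Laplacian.laplacian u x = Laplacian.laplacian u y := by
  set T : Set Plane := {z | u z = u x} with hT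
  have hTc : PreconnectedSpace T :=
    isPreconnected_iff_preconnectedSpace.1 (h.isPreconnected_level rfl hx)
  have hloc : IsLocallyConstant fun z : T => Laplacian.laplacian u (z : Plane) := by
    refine (IsLocallyConstant.iff_eventually_eq _).2 fun z => ?_
    have hz : u z = u x := z.2
    have hcrit : fderiv ℝ u z ≠ 0 := fun h0 => by linarith [h.eq_one _ h0]
    obtain ⟨N, hN, hNeq⟩ := eventually_eq_of_hasFDerivAt_smul h.contDiff hH hcrit
    filter_upwards [continuous_subtype_val.continuousAt.preimage_mem_nhds hN] with w hw
    exact hNeq _ hw _ (mem_of_mem_nhds hN) ((show u w = u x from w.2).trans hz.symm)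
  exact hloc.apply_eq_of_preconnectedSpace (⟨x, rfl⟩ : T) ⟨y, hxy.symm⟩

/-- Near the level `1`, the Laplacian at any point is close to its value at a boundary point `y` of
the critical set, since every level just below `1` is attained near `y`. -/
lemma exists_forall_abs_laplacian_sub_lt (h : IsPeaked u)
    (hH : ∀ x, HasFDerivAt H (Laplacian.laplacian u x • fderiv ℝ u x) x) {y : Plane}
    (hy : u y = 1) (hycl : y ∈ closure {x | u x < 1}) {ε : ℝ} (hε : 0 < ε) :
    ∃ s < 1, ∀ z, s ≤ u z → u z < 1 →
      |Laplacian.laplacian u z - Laplacian.laplacian u y| < ε := by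
  obtain ⟨r, hr, hball⟩ := Metric.continuous_iff.1 h.continuous_laplacian y ε hε
  obtain ⟨x, hx, hxy⟩ := Metric.mem_closure_iff.1 hycl r hr
  refine ⟨u x, hx, fun z hxz hz1 => ?_⟩
  obtain ⟨w, hw, hwz⟩ := (convex_segment x y).isPreconnected.intermediate_value
    (left_mem_segment ℝ x y) (right_mem_segment ℝ x y) h.continuous.continuousOn
    ⟨hxz, hz1.le.trans hy.ge⟩
  have hwb : dist w y < r := (convex_ball y r).segment_subset (by simpa [dist_comm] using hxy)
    (Metric.mem_ball_self hr) hw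
  rw [h.laplacian_eq_of_lt hH hz1 hwz.symm, ← Real.dist_eq]
  exact hball w hwb

lemma laplacian_eq_of_mem_closure (h : IsPeaked u)
    (hH : ∀ x, HasFDerivAt H (Laplacian.laplacian u x • fderiv ℝ u x) x) {y y' : Plane}
    (hy : u y = 1) (hycl : y ∈ closure {x | u x < 1}) (hy' : u y' = 1)
    (hycl' : y' ∈ closure {x | u x < 1}) :
    Laplacian.laplacian u y = Laplacian.laplacian u y' := by
  refine eq_of_forall_dist_le fun ε hε => ?_
  obtain ⟨s, hs, hsε⟩ := h.exists_forall_abs_laplacian_sub_lt hH hy hycl (half_pos hε)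
  obtain ⟨s', hs', hsε'⟩ := h.exists_forall_abs_laplacian_sub_lt hH hy' hycl' (half_pos hε)
  obtain ⟨z, hz1, hz⟩ := mem_closure_iff_nhds.1 hycl {z | max s s' < u z}
    ((isOpen_lt continuous_const h.continuous).mem_nhds (by simp [hy, hs, hs']))
  have hz1' : max s s' < u z := hz1
  have e1 := hsε z ((le_max_left _ _).trans hz1'.le) hz
  have e2 := hsε' z ((le_max_right _ _).trans hz1'.le) hz
  rw [Real.dist_eq]
  rw [abs_lt] at e1 e2
  rw [abs_le]
  constructor <;> linarith

/-- The Laplacian is constant on the critical set: it is constant on the boundary, and if the interior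
is nonempty, it vanishes there, hence at the boundary points adherent to the interior. -/
lemma laplacian_eq_of_eq_one (h : IsPeaked u)
    (hH : ∀ x, HasFDerivAt H (Laplacian.laplacian u x • fderiv ℝ u x) x) {x y : Plane}
    (hx : u x = 1) (hy : u y = 1) : Laplacian.laplacian u x = Laplacian.laplacian u y := by
  set W : Set Plane := interior {x | u x = 1} with hW
  have hcl : closure {x | u x < 1} = Wᶜ := by
    rw [hW, ← closure_compl]
    congr 1
    ext z
    exact (lt_iff_le_and_ne.trans (and_iff_right (h.le_one z)))
  have hW0 : ∀ z ∈ W, Laplacian.laplacian u z = 0 := by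
    intro z hz
    have : u =ᶠ[𝓝 z] fun _ => (1 : ℝ) := mem_interior_iff_mem_nhds.1 hz
    rw [(InnerProductSpace.laplacian_congr_nhds this).self_of_nhds]
    simp
  have key : ∀ z, u z = 1 → W.Nonempty → Laplacian.laplacian u z = 0 := by
    intro z hz hWne
    by_cases hzW : z ∈ W
    · exact hW0 z hzW
    obtain ⟨x₀, hx₀⟩ := h.exists_lt
    have hWu : W ≠ Set.univ := fun hWu =>
      hx₀.ne (interior_subset (s := {x | u x = 1}) (hWu.symm.subset (Set.mem_univ x₀)))
    obtain ⟨b, hb⟩ := nonempty_frontier_iff.2 ⟨hWne, hWu⟩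
    have hb0 : Laplacian.laplacian u b = 0 :=
      closure_minimal hW0 (isClosed_eq h.continuous_laplacian continuous_const)
        (frontier_subset_closure hb)
    have hb1 : u b = 1 := closure_minimal interior_subset
      (isClosed_eq h.continuous continuous_const) (frontier_subset_closure hb)
    rw [← hb0]
    refine h.laplacian_eq_of_mem_closure hH hz (hcl ▸ hzW) hb1 (hcl ▸ ?_)
    exact fun hbW => hb.2 (interior_maximal subset_rfl isOpen_interior hbW)
  rcases W.eq_empty_or_nonempty with hWe | hWne
  · have : ∀ z, z ∈ closure {x | u x < 1} := fun z => by rw [hcl, hWe]; simp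
    exact h.laplacian_eq_of_mem_closure hH hx (this x) hy (this y)
  · rw [key x hx hWne, key y hy hWne]

lemma laplacian_eq_of_eq (h : IsPeaked u)
    (hH : ∀ x, HasFDerivAt H (Laplacian.laplacian u x • fderiv ℝ u x) x) {x y : Plane}
    (hxy : u x = u y) : Laplacian.laplacian u x = Laplacian.laplacian u y := by
  rcases (h.le_one x).lt_or_eq with hx | hx
  · exact h.laplacian_eq_of_lt hH hx hxy
  · exact h.laplacian_eq_of_eq_one hH hx (hxy ▸ hx)

/-- A continuous function that is constant on the level sets of `u` is a continuous function of `u`,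
because `u` is proper on the sets `{a ≤ u}` with `a > inf u`. -/
theorem exists_continuousOn_comp_eq (h : IsPeaked u) {g : Plane → ℝ} (hg : Continuous g)
    (hgu : ∀ x y, u x = u y → g x = g y) :
    ∃ f : ℝ → ℝ, ContinuousOn f (Set.range u) ∧ ∀ x, g x = f (u x) := by
  set σ := Function.invFun u with hσ
  have hσu : ∀ t ∈ Set.range u, u (σ t) = t := fun t ht => Function.invFun_eq ht
  refine ⟨fun t => g (σ t), ?_, fun x => hgu _ _ (hσu _ ⟨x, rfl⟩).symm⟩
  rintro _ ⟨x, rfl⟩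
  obtain ⟨x₀, hx₀⟩ := h.not_isMinimum x
  obtain ⟨a, ha₀, ha⟩ := exists_between hx₀
  -- Along an ultrafilter, the chosen points of the level sets stay in a compact set and converge.
  refine tendsto_iff_ultrafilter _ _ _ |>.2 fun F hF => ?_
  have hFr : ∀ᶠ t in (F : Filter ℝ), t ∈ Set.range u :=
    hF self_mem_nhdsWithin
  have hFa : ∀ᶠ t in (F : Filter ℝ), a ≤ t :=
    hF (mem_nhdsWithin_of_mem_nhds (Ici_mem_nhds ha))
  have hK : {z | a ≤ u z} ∈ F.map σ := by
    refine Ultrafilter.mem_map.2 ?_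
    filter_upwards [hFr, hFa] with t ht hat
    simpa [hσu t ht] using hat
  obtain ⟨z, -, hz⟩ := (h.isCompact_ge ha₀).ultrafilter_le_nhds' (F.map σ) hK
  have hz' : Tendsto σ F (𝓝 z) := hz
  have huz : u z = u x := by
    refine tendsto_nhds_unique ((h.continuous.tendsto z).comp hz') ?_
    refine Tendsto.congr' (f₁ := id) ?_ (hF.trans nhdsWithin_le_nhds)
    filter_upwards [hFr] with t ht using (hσu t ht).symm
  have hgz : g z = g (σ (u x)) := hgu _ _ (huz.trans (hσu _ ⟨x, rfl⟩).symm)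
  have hlim := (hg.tendsto z).comp hz'
  rw [hgz] at hlim
  exact hlim

theorem exists_limit (h : IsPeaked u) :
    ∃ L : EReal, L < 1 ∧ Tendsto (fun x => (u x : EReal)) (cocompact Plane) (𝓝 L) ∧
      IsGLB (Set.range fun x => (u x : EReal)) L ∧ (∀ x, L < (u x : EReal)) ∧
      Set.range u = {t : ℝ | L < (t : EReal) ∧ t ≤ 1} := by
  have hlt : ∀ x, (⨅ y, (u y : EReal)) < u x := fun x => by
    obtain ⟨y, hy⟩ := h.not_isMinimum x
    exact (iInf_le _ y).trans_lt (EReal.coe_lt_coe_iff.2 hy)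
  obtain ⟨z, hz⟩ := h.exists_eq_one
  refine ⟨⨅ y, (u y : EReal), ?_, ?_, isGLB_iInf, hlt, ?_⟩
  · simpa [hz] using hlt z
  · refine tendsto_order.2 ⟨fun a ha => Eventually.of_forall fun x => ha.trans (hlt x), ?_⟩
    intro b hb
    obtain ⟨x₀, hx₀⟩ := iInf_lt_iff.1 hb
    obtain ⟨s, hs, hsb⟩ := EReal.lt_iff_exists_real_btwn.1 hx₀
    filter_upwards [h.eventually_lt (EReal.coe_lt_coe_iff.1 hs)] with x hx
    exact (EReal.coe_lt_coe_iff.2 hx).trans hsb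
  · ext t
    constructor
    · rintro ⟨x, rfl⟩
      exact ⟨hlt x, h.le_one x⟩
    · rintro ⟨ht, ht1⟩
      obtain ⟨x₀, hx₀⟩ := iInf_lt_iff.1 ht
      obtain ⟨w, -, hw⟩ := isPreconnected_univ.intermediate_value (Set.mem_univ x₀)
        (Set.mem_univ z) h.continuous.continuousOn
        ⟨(EReal.coe_lt_coe_iff.1 hx₀).le, ht1.trans hz.ge⟩
      exact ⟨w, hw⟩

end IsPeaked

/-! ### Normalization and conclusion -/

lemma fderiv_neg_add_const (u : Plane → ℝ) (c : ℝ) :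
    fderiv ℝ (fun x => - u x + c) = fun x => - fderiv ℝ u x := by
  ext1 x
  rw [fderiv_add_const, fderiv_fun_neg]

lemma laplacian_neg_add_const (u : Plane → ℝ) (c : ℝ) (x : Plane) :
    Laplacian.laplacian (fun x => - u x + c) x = - Laplacian.laplacian u x := by
  rw [laplacian_eq_sum, laplacian_eq_sum, fderiv_neg_add_const, fderiv_fun_neg]
  simp [add_comm]

lemma laplacian_add_const (u : Plane → ℝ) (c : ℝ) (x : Plane) :
    Laplacian.laplacian (fun x => u x + c) x = Laplacian.laplacian u x := by
  have hfd : fderiv ℝ (fun x => u x + c) = fderiv ℝ u := funext fun y => fderiv_add_const _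
  rw [laplacian_eq_sum, laplacian_eq_sum, hfd]

/-- By Sard's theorem, `u` is constant on its connected critical set; up to sign and an additive
constant, that value is `1` and is the maximum. The equation `∇H = Δu ∇u` is invariant under both
changes, with the same `H`. -/
theorem exists_isPeaked {u H : Plane → ℝ} (hu : ContDiff ℝ 2 u) (hosc : SmallOscillation u)
    (hH : ∀ x, HasFDerivAt H (Laplacian.laplacian u x • fderiv ℝ u x) x)
    (hne : {x | fderiv ℝ u x = 0} ≠ Set.univ) (hconn : IsPreconnected {x | fderiv ℝ u x = 0}) :
    ∃ w : Plane → ℝ, ((∃ c : ℝ, ∀ x, w x = u x + c) ∨ (∃ c : ℝ, ∀ x, w x = - u x + c)) ∧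
      IsPeaked w ∧ ∀ x, HasFDerivAt H (Laplacian.laplacian w x • fderiv ℝ w x) x := by
  obtain ⟨z, hz⟩ := hosc.exists_critical hu.continuous
  have hc : ∀ x, fderiv ℝ u x = 0 → u x = u z := fun x hx =>
    hconn.eq_of_critical hu (fun _ h => h) hx hz
  obtain ⟨x₀, hx₀⟩ : ∃ x₀, u x₀ ≠ u z := by
    by_contra! hcon
    refine hne (Set.eq_univ_of_forall fun x => ?_)
    rw [Set.mem_ofPred_eq, funext hcon]
    simp
  rcases hosc.le_or_ge hu.continuous hc with hle | hge
  · refine ⟨fun x => u x + (1 - u z), Or.inl ⟨_, fun _ => rfl⟩, ?_, ?_⟩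
    · have hfd : fderiv ℝ (fun x => u x + (1 - u z)) = fderiv ℝ u :=
        funext fun y => fderiv_add_const _
      refine ⟨hu.add contDiff_const, hosc.add_const _, fun x => by linarith [hle x],
        fun x hx => ?_, by rwa [hfd], x₀, ?_⟩
      · rw [hfd] at hx
        linarith [hc x hx]
      · linarith [(hle x₀).lt_of_ne hx₀]
    · intro x
      rw [laplacian_add_const, fderiv_add_const]
      exact hH x
  · refine ⟨fun x => - u x + (1 + u z), Or.inr ⟨_, fun _ => rfl⟩, ?_, ?_⟩
    · refine ⟨hu.neg.add contDiff_const, hosc.neg_add _, fun x => by linarith [hge x],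
        fun x hx => ?_, ?_, x₀, ?_⟩
      · rw [fderiv_neg_add_const, neg_eq_zero] at hx
        linarith [hc x hx]
      · simpa [fderiv_neg_add_const] using hconn
      · linarith [(hge x₀).lt_of_ne hx₀.symm]
    · intro x
      rw [laplacian_neg_add_const, fderiv_neg_add_const, neg_smul_neg]
      exact hH x

lemma IsStreamFunction.smallOscillation {u : Plane → ℝ} {v : Plane → Plane}
    (h : IsStreamFunction u v) (hv : ContDiff ℝ 1 v) (hL2 : MemLp v 2 volume) :
    SmallOscillation u := fun _ hε R₀ =>
  exists_small_oscillation_sphere ((h.contDiff_two hv).of_le (by norm_num))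
    (by rw [h.fderiv_eq]; exact perpForm.comp_memLp' hL2) hε R₀

theorem theorem1p1 (v : Plane → Plane) (hE : IsStationaryEuler v) (hL2 : MemLp v 2 volume) :
    -- there is a stagnation point
    (stagnationSet v).Nonempty ∧
    -- the stream function exists, and is unique up to an additive constant
    (∃ u : Plane → ℝ, IsStreamFunction u v) ∧
    (∀ u₁ u₂ : Plane → ℝ, IsStreamFunction u₁ v → IsStreamFunction u₂ v →
      ∃ c : ℝ, ∀ x, u₂ x = u₁ x + c) ∧
    (∀ u : Plane → ℝ, IsStreamFunction u v →
      stagnationSet v ≠ Set.univ → IsPreconnected (stagnationSet v) →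
      -- `w` is `u` or `-u`, up to an additive constant
      ∃ w : Plane → ℝ,
        ((∃ c : ℝ, ∀ x, w x = u x + c) ∨ (∃ c : ℝ, ∀ x, w x = - u x + c)) ∧
        ContDiff ℝ 2 w ∧
        (∀ x ∈ stagnationSet v, w x = 1) ∧
        IsGreatest (Set.range w) 1 ∧
        ∃ L : EReal,
          L < 1 ∧
          Tendsto (fun x => (w x : EReal)) (cocompact Plane) (𝓝 L) ∧
          IsGLB (Set.range fun x => (w x : EReal)) L ∧
          (∀ x, L < (w x : EReal)) ∧
          ∃ f : ℝ → ℝ,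
            ContinuousOn f {t : ℝ | L < (t : EReal) ∧ t ≤ 1} ∧
            ∀ x, - Laplacian.laplacian w x = f (w x)) := by
  obtain ⟨u₀, hu₀⟩ := exists_streamFunction hE.contDiff hE.incompressible
  refine ⟨?_, ⟨u₀, hu₀⟩, fun u₁ u₂ h₁ h₂ => h₁.exists_eq_add_const h₂, ?_⟩
  · rw [hu₀.stagnationSet_eq]
    exact (hu₀.smallOscillation hE.contDiff hL2).exists_critical hu₀.differentiable.continuous
  · intro u hu hne hconn
    have hS := hu.stagnationSet_eq
    obtain ⟨H, hH⟩ := hu.exists_bernoulli hE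
    obtain ⟨w, hwu, hw, hwH⟩ := exists_isPeaked (hu.contDiff_two hE.contDiff)
      (hu.smallOscillation hE.contDiff hL2) hH (hS ▸ hne) (hS ▸ hconn)
    have hcrit : ∀ x, fderiv ℝ u x = 0 → fderiv ℝ w x = 0 := by
      intro x hx
      rcases hwu with ⟨c, hc⟩ | ⟨c, hc⟩
      · rw [funext hc, fderiv_add_const, hx]
      · rw [funext hc, fderiv_neg_add_const]
        simp [hx]
    obtain ⟨L, hL1, hlim, hglb, hlt, hrange⟩ := hw.exists_limit
    obtain ⟨f, hf, hwf⟩ := hw.exists_continuousOn_comp_eq hw.continuous_laplacian.neg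
      fun x y hxy => congrArg Neg.neg (hw.laplacian_eq_of_eq hwH hxy)
    obtain ⟨z, hz⟩ := hw.exists_eq_one
    refine ⟨w, hwu, hw.contDiff, fun x hx => hw.eq_one x (hcrit x (hS.subset hx)),
      ⟨⟨z, hz⟩, ?_⟩, L, hL1, hlim, hglb, hlt, f, hrange ▸ hf, hwf⟩
    rintro _ ⟨x, rfl⟩
    exact hw.le_one x
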